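/- Let $K$ be a field, $n\ge 3$ and $S=K[x_1,\dots,x_n]$ with the standard grading, and let $J_{n,3}=(x_1x_2x_3,\ x_2x_3x_4,\ \dots,\ x_{n-2}x_{n-1}x_n,\ x_{n-1}x_nx_1,\ x_nx_1x_2)$ be the path ideal of length $3$ of the $n$-cycle, that is, the ideal of $S$ generated by the products of the vertices of all paths with three vertices in the cycle graph on $x_1,\dots,x_n$. Then $$\operatorname{depth}(S/J_{n,3})\ \ge\ n-\lfloor n/4\rfloor-\lceil n/4\rceil \qquad\text{and}\qquad \operatorname{sdepth}(S/J_{n,3})\ \ge\ n-\lfloor n/4\rfloor-\lceil n/4\rceil .$$ Here $\operatorname{depth}(M)=\min\{i\mid \operatorname{Ext}^i_S(S/\mathfrak m,M)\ne 0\}$ with $\mathfrak m=(x_1,\dots,x_n)$. For a finitely generated $\mathbb Z^n$-graded $S$-module $M$, a Stanley space of $M$ is a subspace $uK[Z]$, spanned over $K$ by the elements $uv$ with $v$ a monomial in the variables in $Z$, where $u\in M$ is homogeneous, $Z\subseteq\{x_1,\dots,x_n\}$, and $uK[Z]$ is a free $K[Z]$-module with basis $u$. A Stanley decomposition is an expression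 $M=\bigoplus_{i=1}^r u_iK[Z_i]$ of $M$ as a finite direct sum, over $K$, of Stanley spaces, and $\operatorname{sdepth}(M)$ is the maximum of $\min_i|Z_i|$ over all Stanley decompositions of $M$. The module $S/J_{n,3}$ carries the $\mathbb Z^n$-grading induced by that of $S$. -/

import Mathlib

noncomputable section

/-- The path ideal of length `m` of a graph `G` on the vertex set `σ`: the ideal of `K[x_v | v ∈ σ]`
generated by the monomials `∏ x_v`, `v` running over the vertices of a path of length `m` in `G`.
The length of a path counts its vertices here, so it is one more than the number of edges
`p.length` of the walk `p`. -/
def pathIdeal (K : Type*) [Field K] {σ : Type*} (G : SimpleGraph σ) (m : ℕ) :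
    Ideal (MvPolynomial σ K) :=
  Ideal.span {f | ∃ (u v : σ) (p : G.Walk u v), p.IsPath ∧ p.length + 1 = m ∧
    f = (p.support.map MvPolynomial.X).prod}

/-- The ideal `J_{n,m}` of `K[x_0, …, x_{n-1}]`: the path ideal of length `m` of the `n`-cycle. -/
abbrev cyclePathIdeal (K : Type*) [Field K] (n m : ℕ) : Ideal (MvPolynomial (Fin n) K) :=
  pathIdeal K (SimpleGraph.cycleGraph n) m

/-- The depth of an `R`-module `M` with respect to an ideal `I`: the least `i` such that
`Ext^i_R(R/I, M) ≠ 0` (and `⊤` if there is none). -/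
def moduleDepth.{u} {R : Type u} [CommRing R] (I : Ideal R) (M : Type u) [AddCommGroup M]
    [Module R M] : ℕ∞ :=
  ⨅ (i : ℕ) (_ : Nontrivial
    (CategoryTheory.Abelian.Ext (ModuleCat.of R (R ⧸ I)) (ModuleCat.of R M) i)), (i : ℕ∞)

/-- The depth of a module over the standard graded polynomial ring `S = K[x_v | v ∈ σ]`: the depth
with respect to the ideal generated by all the variables. -/
abbrev gradedDepth.{u} (K : Type u) [Field K] (σ : Type) (M : Type u) [AddCommGroup M]
    [Module (MvPolynomial σ K) M] : ℕ∞ :=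
  moduleDepth (MvPolynomial.idealOfVars σ K) M

section Stanley

variable {K : Type*} [Field K] {σ : Type*} {M : Type*} [AddCommGroup M] [Module K M]
  [Module (MvPolynomial σ K) M]

/-- The subspace `u K[Z]`: the `K`-span of the elements `v u`, `v` a monomial in the variables
belonging to `Z`. -/
def stanleySubspace (K : Type*) [Field K] {σ : Type*} {M : Type*} [AddCommGroup M] [Module K M]
    [Module (MvPolynomial σ K) M] (u : M) (Z : Finset σ) : Submodule K M :=
  Submodule.span K {w | ∃ s : σ →₀ ℕ, s.support ⊆ Z ∧ w = MvPolynomial.monomial s (1 : K) • u}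

/-- `u K[Z]` is a Stanley space of the multigraded module `M = ⨁ 𝓜 a`: `u` is homogeneous and the
cyclic `K[Z]`-module `u K[Z]` is free on `u`, that is, no nonzero polynomial in the variables
belonging to `Z` kills `u`. -/
def IsStanleySpace (𝓜 : (σ → ℤ) → Submodule K M) (u : M) (Z : Finset σ) : Prop :=
  (∃ a, u ∈ 𝓜 a) ∧
    ∀ f ∈ MvPolynomial.supported K (Z : Set σ), f • u = 0 → f = 0

/-- A Stanley decomposition of the multigraded module `M = ⨁ 𝓜 a`: a finite family of Stanley
spaces of `M` of which `M` is the direct sum, as a `K`-vector space. -/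
structure StanleyDecomposition (𝓜 : (σ → ℤ) → Submodule K M) where
  r : ℕ
  u : Fin r → M
  Z : Fin r → Finset σ
  isStanleySpace : ∀ i, IsStanleySpace 𝓜 (u i) (Z i)
  isInternal : DirectSum.IsInternal fun i => stanleySubspace K (u i) (Z i)

/-- The Stanley depth of a Stanley decomposition: the least dimension `|Z i|` of its Stanley
spaces. -/
def StanleyDecomposition.sdepth {𝓜 : (σ → ℤ) → Submodule K M} (D : StanleyDecomposition 𝓜) : ℕ∞ :=
  ⨅ i, ((D.Z i).card : ℕ∞)

/-- The Stanley depth of the multigraded module `M = ⨁ 𝓜 a`: the largest Stanley depth of its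
Stanley decompositions. -/
def stanleyDepth (𝓜 : (σ → ℤ) → Submodule K M) : ℕ∞ :=
  ⨆ D : StanleyDecomposition 𝓜, D.sdepth

end Stanley

/-- The multigrading of `S/I`, for a monomial ideal `I` of `S = K[x_v | v ∈ σ]`: the component of
degree `a ∈ ℤ^σ` is the image of the span of the monomial with exponent `a` (and zero if `a` has a
negative entry). -/
def quotientMultigrading {K : Type*} [Field K] {σ : Type*} (I : Ideal (MvPolynomial σ K))
    (a : σ → ℤ) : Submodule K (MvPolynomial σ K ⧸ I) :=
  Submodule.span K {w | ∃ s : σ →₀ ℕ, (∀ v, (s v : ℤ) = a v) ∧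
    w = Ideal.Quotient.mk I (MvPolynomial.monomial s 1)}

end

/-!
Both bounds come from one filtration of `S/J`, where `J = J_{n,3}`. For a monomial ideal `I` and a
variable `x` there is an exact sequence `0 → S/(I : x) → S/I → S/(I + (x)) → 0`, the first map being
multiplication by `x`. Choosing variables one after the other, each choice depending on the earlier
ones, gives a binary tree, a *decision tree*: at each node some vertices `A` have been inverted
(colon) and some vertices `B` have been killed (added to the ideal). A branch ends when a generator
is contained in `A`, so that the quotient is zero, or when each generator meets `B`, so that the
quotient is the polynomial ring `S/(x_b | b ∈ B)` in `n - |B|` variables. If at most `k` vertices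
are killed along each branch, then

* `Ext^i(S/𝔪, S/J) = 0` for `i < n - k`, by the long exact sequence
  (`HasDecisionTree.subsingleton_ext`);
* the monomials outside `J` split into finitely many cells `s + ℕ^Z` with `|Z| ≥ n - k`, which is a
  Stanley decomposition (`HasDecisionTree.hasStanleyPartition` and
  `le_stanleyDepth_of_hasStanleyPartition`).

It remains to find a decision tree for the windows of three consecutive vertices of the `n`-cycle
with at most `k = ⌊n/4⌋ + ⌈n/4⌉` kills (`hasDecisionTree_cycle`). The vertices `0` and `n - 1` are
queried; as soon as one of them is killed, or, when both are inverted, once their two further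
neighbours have been killed, the cycle is cut into a path. For a path with `m` vertices
`⌊m/4⌋ + ⌊(m+1)/4⌋` kills suffice (`hasDecisionTree_path`), and `⌊m/2⌋` when moreover the vertex
before the path has been inverted (`hasDecisionTree_markedPath`); two inverted vertices at distance
at most two force the kill of a vertex which forms a window with them.
-/

/-! ### Vanishing of `Ext` along the colon sequence -/

section

open CategoryTheory

/-- Multiplication by `x` as a map `R/I' → R/I`, defined when `x I' ⊆ I`. -/
def quotientMul {R : Type*} [CommRing R] {I I' : Ideal R} (x : R)
    (h : ∀ f ∈ I', x * f ∈ I) : (R ⧸ I') →ₗ[R] (R ⧸ I) :=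
  Submodule.mapQ I' I (LinearMap.mulLeft R x) fun f hf => h f hf

lemma quotientMul_injective {R : Type*} [CommRing R] {I I₁ : Ideal R} (x : R)
    (h₁ : ∀ f, f ∈ I₁ ↔ x * f ∈ I) :
    Function.Injective (quotientMul x fun f => (h₁ f).1) := by
  refine (injective_iff_map_eq_zero _).2 fun f hf => ?_
  obtain ⟨f, rfl⟩ := Submodule.Quotient.mk_surjective _ f
  exact (Submodule.Quotient.mk_eq_zero I₁).2 ((h₁ f).2 ((Submodule.Quotient.mk_eq_zero I).1 hf))

lemma quotientMul_exact {R : Type*} [CommRing R] {I I₁ I₂ : Ideal R} (x : R)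
    (h₁ : ∀ f ∈ I₁, x * f ∈ I) (h₂ : I₂ = I ⊔ Ideal.span {x}) :
    Function.Exact (quotientMul x h₁)
      (Submodule.factor (le_sup_left.trans_eq h₂.symm : I ≤ I₂)) := by
  intro f
  obtain ⟨f, rfl⟩ := Submodule.Quotient.mk_surjective _ f
  refine (Submodule.Quotient.mk_eq_zero I₂).trans ?_
  rw [h₂, sup_comm, Ideal.mem_span_singleton_sup]
  constructor
  · rintro ⟨a, b, hb, rfl⟩
    refine ⟨Submodule.Quotient.mk a, (Submodule.Quotient.eq I).2 ?_⟩
    rw [LinearMap.mulLeft_apply, mul_comm, sub_add_cancel_left]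
    exact I.neg_mem hb
  · rintro ⟨a, ha⟩
    obtain ⟨a, rfl⟩ := Submodule.Quotient.mk_surjective _ a
    refine ⟨a, f - x * a, ?_, by rw [mul_comm a]; exact add_sub_cancel _ f⟩
    rw [← neg_sub]
    exact I.neg_mem ((Submodule.Quotient.eq I).1 ha)

/-- The sequence `0 → R/(I : x) → R/I → R/(I + (x)) → 0`. -/
def colonSequence.{u} {R : Type u} [CommRing R] {I I₁ I₂ : Ideal R} (x : R)
    (h₁ : ∀ f, f ∈ I₁ ↔ x * f ∈ I) (h₂ : I₂ = I ⊔ Ideal.span {x}) :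
    ShortComplex (ModuleCat.{u} R) :=
  ShortComplex.mk (ModuleCat.ofHom (quotientMul x fun f => (h₁ f).1))
    (ModuleCat.ofHom (Submodule.factor (le_sup_left.trans_eq h₂.symm : I ≤ I₂)))
    (ModuleCat.hom_ext (quotientMul_exact x (fun f => (h₁ f).1) h₂).linearMap_comp_eq_zero)

lemma colonSequence_shortExact.{u} {R : Type u} [CommRing R] {I I₁ I₂ : Ideal R} (x : R)
    (h₁ : ∀ f, f ∈ I₁ ↔ x * f ∈ I) (h₂ : I₂ = I ⊔ Ideal.span {x}) :
    (colonSequence x h₁ h₂).ShortExact where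
  exact := (ShortComplex.ShortExact.moduleCat_exact_iff_function_exact _).2
    (quotientMul_exact x (fun f => (h₁ f).1) h₂)
  mono_f := (ModuleCat.mono_iff_injective _).2 (quotientMul_injective x h₁)
  epi_g := (ModuleCat.epi_iff_surjective _).2
    (Submodule.factor_surjective (le_sup_left.trans_eq h₂.symm))

/-- `Ext^i(N, -)` vanishes on `R/I` as soon as it vanishes on `R/(I : x)` and `R/(I + (x))`. -/
lemma subsingleton_ext_of_colon.{u} {R : Type u} [CommRing R] {I I₁ I₂ : Ideal R} (x : R)
    (h₁ : ∀ f, f ∈ I₁ ↔ x * f ∈ I) (h₂ : I₂ = I ⊔ Ideal.span {x}) (N : ModuleCat.{u} R) (i : ℕ)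
    (e₁ : Subsingleton (Abelian.Ext N (ModuleCat.of R (R ⧸ I₁)) i))
    (e₂ : Subsingleton (Abelian.Ext N (ModuleCat.of R (R ⧸ I₂)) i)) :
    Subsingleton (Abelian.Ext N (ModuleCat.of R (R ⧸ I)) i) := by
  refine subsingleton_of_forall_eq 0 fun a => ?_
  obtain ⟨b, rfl⟩ := Abelian.Ext.covariant_sequence_exact₂ N
    (colonSequence_shortExact x h₁ h₂) a (e₂.elim _ _)
  rw [show b = 0 from e₁.elim _ _]
  exact Abelian.Ext.zero_comp ..

/-- If `x` annihilates `N` and is a nonzerodivisor on `R/I`, then multiplication by `x` on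
`Ext^i(N, R/I)` is zero, and it is injective when `Ext^{i-1}(N, R/(I + (x))) = 0`. -/
lemma subsingleton_ext_of_regular.{u} {R : Type u} [CommRing R] {I I₂ : Ideal R} (x : R)
    (h₁ : ∀ f, f ∈ I ↔ x * f ∈ I) (h₂ : I₂ = I ⊔ Ideal.span {x}) (N : ModuleCat.{u} R)
    (hN : x ∈ Module.annihilator R N) (i : ℕ)
    (e₂ : ∀ j, j + 1 = i → Subsingleton (Abelian.Ext N (ModuleCat.of R (R ⧸ I₂)) j)) :
    Subsingleton (Abelian.Ext N (ModuleCat.of R (R ⧸ I)) i) := by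
  refine subsingleton_of_forall_eq 0 fun a => ?_
  have hf : (colonSequence x h₁ h₂).f = x • 𝟙 (ModuleCat.of R (R ⧸ I)) := by
    ext f
    obtain ⟨f, rfl⟩ := Ideal.Quotient.mk_surjective f
    rfl
  have ha : a.comp (Abelian.Ext.mk₀ (colonSequence x h₁ h₂).f) (add_zero i) = 0 := by
    rw [hf]
    exact DFunLike.congr_fun (congrArg AddCommGrpCat.Hom.hom
      (Abelian.Ext.postcomp_smul_id_eq_zero_of_mem_annihilator
      (M := ModuleCat.of R (R ⧸ I)) hN i)) a
  have hS := colonSequence_shortExact x h₁ h₂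
  cases i with
  | zero =>
    have := hS.mono_f
    exact Abelian.Ext.postcomp_mk₀_injective_of_mono N (colonSequence x h₁ h₂).f
      (ha.trans (map_zero _).symm)
  | succ i =>
    obtain ⟨b, rfl⟩ := Abelian.Ext.covariant_sequence_exact₁ N hS a ha rfl
    rw [show b = 0 from (e₂ i rfl).elim _ _]
    exact Abelian.Ext.zero_comp ..

end

/-! ### Decision trees and the depth -/

/-- A decision tree for the squarefree monomial ideal generated by the `∏_{v ∈ e} x_v`, `e ∈ E`.
At a node the vertices in `A` have been inverted (passing to a colon ideal) and those in `B` have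
been killed (added to the ideal); `HasDecisionTree E A B k` says that one can go on, querying one
vertex at a time and choosing the next one according to the answers, so that along each branch at
most `k` more vertices are killed before the ideal becomes the unit ideal (`dead`) or the ideal
`(x_b | b ∈ B)` (`done`). -/
inductive HasDecisionTree {σ : Type*} [DecidableEq σ] (E : Set (Finset σ)) :
    Finset σ → Finset σ → ℕ → Prop
  | done {A B : Finset σ} {k : ℕ} (h : ∀ e ∈ E, ∃ v ∈ e, v ∈ B) : HasDecisionTree E A B k
  | dead {A B e : Finset σ} {k : ℕ} (he : e ∈ E) (h : e ⊆ A) : HasDecisionTree E A B k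
  | query {A B : Finset σ} {k : ℕ} (x : σ) (hA : x ∉ A) (hB : x ∉ B)
      (h₁ : HasDecisionTree E (insert x A) B (k + 1))
      (h₂ : HasDecisionTree E A (insert x B) k) : HasDecisionTree E A B (k + 1)

lemma HasDecisionTree.mono {σ : Type*} [DecidableEq σ] {E : Set (Finset σ)} {A B : Finset σ}
    {k l : ℕ} (h : HasDecisionTree E A B k) (hl : k ≤ l) : HasDecisionTree E A B l := by
  induction h generalizing l with
  | done h => exact .done h
  | dead he h => exact .dead he h
  | query x hA hB _ _ ih₁ ih₂ =>
    obtain ⟨l, rfl⟩ := Nat.exists_eq_add_of_le' (Nat.le_of_add_left_le hl)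
    exact .query x hA hB (ih₁ hl) (ih₂ (Nat.le_of_succ_le_succ hl))

section

variable {σ : Type} [DecidableEq σ]

/-- The exponents of the monomials in the ideal at the node `(A, B)` of a decision tree. -/
def nodeExponents (E : Set (Finset σ)) (A B : Finset σ) : Set (σ →₀ ℕ) :=
  {s | (∃ e ∈ E, e ⊆ s.support ∪ A) ∨ ∃ b ∈ B, s b ≠ 0}

lemma isUpperSet_nodeExponents (E : Set (Finset σ)) (A B : Finset σ) :
    IsUpperSet (nodeExponents E A B) := by
  rintro s t hst (⟨e, he, h⟩ | ⟨b, hb, h⟩)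
  · exact .inl ⟨e, he, h.trans (Finset.union_subset_union_left (Finsupp.support_mono hst))⟩
  · exact .inr ⟨b, hb, fun h0 => h (Nat.le_zero.1 (h0 ▸ hst b))⟩

lemma add_single_mem_nodeExponents {E : Set (Finset σ)} {A B : Finset σ} {x : σ} (hx : x ∉ B)
    (s : σ →₀ ℕ) :
    s + Finsupp.single x 1 ∈ nodeExponents E A B ↔ s ∈ nodeExponents E (insert x A) B := by
  have hsupp : (s + Finsupp.single x 1).support ∪ A = s.support ∪ insert x A := by
    ext v
    by_cases hv : v = x <;> simp [hv]
  refine or_congr (by simp only [hsupp]) (exists_congr fun b => and_congr_right fun hb => ?_)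
  simp [(ne_of_mem_of_not_mem hb hx).symm]

lemma mem_nodeExponents_insert {E : Set (Finset σ)} {A B : Finset σ} {x : σ} (s : σ →₀ ℕ) :
    s ∈ nodeExponents E A (insert x B) ↔ s ∈ nodeExponents E A B ∨ s x ≠ 0 := by
  refine (or_congr_right ((Finset.exists_mem_insert ..).trans or_comm)).trans or_assoc.symm

lemma mem_nodeExponents_of_hit {E : Set (Finset σ)} {A B : Finset σ} (hAB : Disjoint A B)
    (h : ∀ e ∈ E, ∃ v ∈ e, v ∈ B) (s : σ →₀ ℕ) :
    s ∈ nodeExponents E A B ↔ ∃ b ∈ B, s b ≠ 0 := by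
  refine or_iff_right_of_imp ?_
  rintro ⟨e, he, hes⟩
  obtain ⟨v, hv, hvB⟩ := h e he
  refine ⟨v, hvB, ?_⟩
  simpa [Finset.disjoint_right.1 hAB hvB] using hes hv

/-- The ideal at the node `(A, B)` of a decision tree. -/
noncomputable def nodeIdeal (K : Type*) [Field K] (E : Set (Finset σ)) (A B : Finset σ) :
    Ideal (MvPolynomial σ K) :=
  MvPolynomial.restrictSupportIdeal K (nodeExponents E A B) (isUpperSet_nodeExponents E A B)

lemma mem_nodeIdeal {K : Type*} [Field K] {E : Set (Finset σ)} {A B : Finset σ}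
    {f : MvPolynomial σ K} :
    f ∈ nodeIdeal K E A B ↔ ∀ s, f.coeff s ≠ 0 → s ∈ nodeExponents E A B := by
  refine (MvPolynomial.mem_restrictSupport_iff K).trans ?_
  simp [Set.subset_def]

lemma mem_nodeIdeal_insert_left {K : Type*} [Field K] {E : Set (Finset σ)} {A B : Finset σ} {x : σ}
    (hx : x ∉ B) (f : MvPolynomial σ K) :
    f ∈ nodeIdeal K E (insert x A) B ↔ MvPolynomial.X x * f ∈ nodeIdeal K E A B := by
  simp only [mem_nodeIdeal]
  constructor
  · intro h s hs
    rw [MvPolynomial.coeff_X_mul'] at hs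
    split_ifs at hs with hx'
    · have := (add_single_mem_nodeExponents hx _).2 (h _ hs)
      rwa [tsub_add_cancel_of_le] at this
      exact Finsupp.single_le_iff.2 (Nat.one_le_iff_ne_zero.2 (Finsupp.mem_support_iff.1 hx'))
    · exact absurd rfl hs
  · intro h s hs
    rw [← add_single_mem_nodeExponents hx]
    apply h
    rwa [add_comm, MvPolynomial.coeff_X_mul]

lemma nodeIdeal_insert_right {K : Type*} [Field K] {E : Set (Finset σ)} {A B : Finset σ} (x : σ) :
    nodeIdeal K E A (insert x B) = nodeIdeal K E A B ⊔ Ideal.span {MvPolynomial.X x} := by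
  apply le_antisymm
  · intro f hf
    rw [mem_nodeIdeal] at hf
    rw [f.as_sum]
    refine Ideal.sum_mem _ fun s hs => ?_
    rcases (mem_nodeExponents_insert s).1 (hf s (MvPolynomial.mem_support_iff.1 hs)) with h | h
    · refine Ideal.mem_sup_left (mem_nodeIdeal.2 fun t ht => ?_)
      rw [MvPolynomial.coeff_monomial] at ht
      exact (ite_ne_right_iff.1 ht).1 ▸ h
    · refine Ideal.mem_sup_right (Ideal.mem_span_singleton.2 ?_)
      exact MvPolynomial.X_dvd_monomial.2 (.inr h)
  · refine sup_le (fun f hf => ?_) ((Ideal.span_singleton_le_iff_mem _).2 ?_)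
    · exact mem_nodeIdeal.2 fun s hs =>
        (mem_nodeExponents_insert s).2 (.inl (mem_nodeIdeal.1 hf s hs))
    · refine mem_nodeIdeal.2 fun s hs => (mem_nodeExponents_insert s).2 (.inr ?_)
      rw [MvPolynomial.coeff_X] at hs
      simp [← (ite_ne_right_iff.1 hs).1]

lemma nodeIdeal_eq_of_hit (K : Type*) [Field K] {E : Set (Finset σ)} {A B : Finset σ}
    (hAB : Disjoint A B) (h : ∀ e ∈ E, ∃ v ∈ e, v ∈ B) :
    nodeIdeal K E A B = nodeIdeal K ∅ ∅ B := by
  ext f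
  simp only [mem_nodeIdeal, mem_nodeExponents_of_hit hAB h,
    mem_nodeExponents_of_hit (E := ∅) (Finset.disjoint_empty_left B) (by simp)]

lemma nodeIdeal_eq_top_of_subset (K : Type*) [Field K] {E : Set (Finset σ)} {A B e : Finset σ}
    (he : e ∈ E) (h : e ⊆ A) : nodeIdeal K E A B = ⊤ := by
  refine (Ideal.eq_top_iff_one _).2 (mem_nodeIdeal.2 fun s _ => ?_)
  exact .inl ⟨e, he, h.trans Finset.subset_union_right⟩

variable [Fintype σ]

open CategoryTheory

/-- `S/(x_b | b ∈ B)` is a polynomial ring in the remaining variables, which form a regular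
sequence on it. -/
lemma subsingleton_ext_vars.{u} (K : Type u) [Field K] (i : ℕ) (B : Finset σ)
    (hi : i + B.card < Fintype.card σ) :
    Subsingleton (Abelian.Ext
      (ModuleCat.of (MvPolynomial σ K) (MvPolynomial σ K ⧸ MvPolynomial.idealOfVars σ K))
      (ModuleCat.of (MvPolynomial σ K) (MvPolynomial σ K ⧸ nodeIdeal K ∅ ∅ B)) i) := by
  induction i using Nat.strong_induction_on generalizing B with
  | _ i ih =>
  obtain ⟨x, hx⟩ : ∃ x, x ∉ B := by
    by_contra! h
    have := Finset.card_eq_iff_eq_univ B |>.2 (Finset.eq_univ_iff_forall.2 h)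
    omega
  refine subsingleton_ext_of_regular (MvPolynomial.X x) (fun f => ?_) (nodeIdeal_insert_right x) _
    ?_ i fun j hj => ih j (by omega) _ ?_
  · rw [← mem_nodeIdeal_insert_left hx, nodeIdeal_eq_of_hit K (A := insert x ∅) _ (by simp)]
    exact Finset.disjoint_insert_left.2 ⟨hx, Finset.disjoint_empty_left B⟩
  · rw [Ideal.annihilator_quotient]
    exact Ideal.subset_span ⟨x, rfl⟩
  · rw [Finset.card_insert_of_notMem hx]
    omega

lemma HasDecisionTree.subsingleton_ext.{u} (K : Type u) [Field K] {E : Set (Finset σ)}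
    {A B : Finset σ} {k : ℕ} (h : HasDecisionTree E A B k) (hAB : Disjoint A B) {i : ℕ}
    (hi : i + k + B.card < Fintype.card σ) :
    Subsingleton (Abelian.Ext
      (ModuleCat.of (MvPolynomial σ K) (MvPolynomial σ K ⧸ MvPolynomial.idealOfVars σ K))
      (ModuleCat.of (MvPolynomial σ K) (MvPolynomial σ K ⧸ nodeIdeal K E A B)) i) := by
  induction h with
  | done h =>
    rw [nodeIdeal_eq_of_hit K hAB h]
    exact subsingleton_ext_vars K i _ (by omega)
  | @dead A B e k he h =>
    rw [nodeIdeal_eq_top_of_subset K he h]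
    have : Limits.IsZero (ModuleCat.of (MvPolynomial σ K)
        (MvPolynomial σ K ⧸ (⊤ : Ideal (MvPolynomial σ K)))) :=
      ModuleCat.isZero_of_subsingleton _
    refine subsingleton_of_forall_eq 0 fun a => ?_
    rw [← a.comp_mk₀_id, this.eq_of_src (𝟙 _) 0, Abelian.Ext.mk₀_zero, Abelian.Ext.comp_zero]
  | @query A B k x hA hB _ _ ih₁ ih₂ =>
    refine subsingleton_ext_of_colon (MvPolynomial.X x) (mem_nodeIdeal_insert_left hB)
      (nodeIdeal_insert_right x) _ i (ih₁ ?_ ?_) (ih₂ ?_ ?_)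
    · exact Finset.disjoint_insert_left.2 ⟨hB, hAB⟩
    · omega
    · exact Finset.disjoint_insert_right.2 ⟨hA, hAB⟩
    · rw [Finset.card_insert_of_notMem hB]
      omega

end

/-! ### Stanley decompositions -/

/-- `T` is covered by finitely many pairwise disjoint cells `s + ℕ^Z` with `d ≤ |Z|`. -/
def HasStanleyPartition {σ : Type*} (T : Set (σ →₀ ℕ)) (d : ℕ) : Prop :=
  ∃ (ι : Type) (_ : Finite ι) (s : ι → σ →₀ ℕ) (Z : ι → Finset σ), (∀ i, d ≤ (Z i).card) ∧
    (∀ i t, t.support ⊆ Z i → t + s i ∈ T) ∧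
    ∀ t ∈ T, ∃! i, ∃ w : σ →₀ ℕ, w.support ⊆ Z i ∧ t = w + s i

lemma hasStanleyPartition_empty {σ : Type*} (d : ℕ) :
    HasStanleyPartition (∅ : Set (σ →₀ ℕ)) d :=
  ⟨Empty, inferInstance, Empty.elim, Empty.elim, fun i => i.elim, fun i => i.elim,
    fun _ h => h.elim⟩

/-- The monomials outside `(x_b | b ∈ B)` form a single cell. -/
lemma hasStanleyPartition_vars {σ : Type*} [Fintype σ] [DecidableEq σ] {B : Finset σ} {d : ℕ}
    (hd : d + B.card ≤ Fintype.card σ) :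
    HasStanleyPartition {t : σ →₀ ℕ | ∀ b ∈ B, t b = 0} d := by
  refine ⟨Unit, inferInstance, fun _ => 0, fun _ => Bᶜ, fun _ => ?_, fun _ t ht b hb => ?_,
    fun t ht => ⟨(), ⟨t, fun v hv => ?_, (add_zero t).symm⟩, fun _ _ => rfl⟩⟩
  · rw [Finset.card_compl]
    omega
  · by_contra h
    exact Finset.mem_compl.1 (ht (Finsupp.mem_support_iff.2 (by simpa using h))) hb
  · exact Finset.mem_compl.2 fun hb => Finsupp.mem_support_iff.1 hv (ht v hb)

/-- The cells for the exponents positive at `x` are those of the first partition, translated. -/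
lemma HasStanleyPartition.split {σ : Type*} {T : Set (σ →₀ ℕ)} {d : ℕ} (x : σ)
    (h₁ : HasStanleyPartition {t | t + Finsupp.single x 1 ∈ T} d)
    (h₂ : HasStanleyPartition {t | t ∈ T ∧ t x = 0} d) : HasStanleyPartition T d := by
  obtain ⟨ι₁, _, s₁, Z₁, hd₁, hc₁, hu₁⟩ := h₁
  obtain ⟨ι₂, _, s₂, Z₂, hd₂, hc₂, hu₂⟩ := h₂
  have hx : ∀ t w s : σ →₀ ℕ, t = w + (s + Finsupp.single x 1) → t x ≠ 0 := by
    rintro t w s rfl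
    simp
  refine ⟨ι₁ ⊕ ι₂, inferInstance, Sum.elim (fun i => s₁ i + Finsupp.single x 1) s₂,
    Sum.elim Z₁ Z₂, Sum.rec hd₁ hd₂, ?_, fun t ht => ?_⟩
  · rintro (i | i) t hti
    · rw [Sum.elim_inl, ← add_assoc]
      exact hc₁ i t hti
    · exact (hc₂ i t hti).1
  · by_cases htx : t x = 0
    · obtain ⟨i, hi, hi'⟩ := hu₂ t ⟨ht, htx⟩
      refine ⟨.inr i, hi, ?_⟩
      rintro (j | j) hj
      · obtain ⟨w, -, hw⟩ := hj
        exact absurd htx (hx _ _ _ hw)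
      · exact congrArg _ (hi' j hj)
    · obtain ⟨t, rfl⟩ : ∃ u, t = u + Finsupp.single x 1 :=
        ⟨t - Finsupp.single x 1, (tsub_add_cancel_of_le
          (Finsupp.single_le_iff.2 (Nat.one_le_iff_ne_zero.2 htx))).symm⟩
      obtain ⟨i, ⟨w, hwi, rfl⟩, hi'⟩ := hu₁ t ht
      refine ⟨.inl i, ⟨w, hwi, add_assoc ..⟩, ?_⟩
      rintro (j | j) ⟨w', hw', h⟩
      · refine congrArg _ (hi' j ⟨w', hw', ?_⟩)
        exact add_right_cancel (h.trans (add_assoc ..).symm)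
      · exact absurd (h ▸ (hc₂ j w' hw').2) htx

lemma HasDecisionTree.hasStanleyPartition {σ : Type} [DecidableEq σ] [Fintype σ]
    {E : Set (Finset σ)} {A B : Finset σ} {k : ℕ} (h : HasDecisionTree E A B k)
    (hAB : Disjoint A B) {d : ℕ} (hd : d + k + B.card ≤ Fintype.card σ) :
    HasStanleyPartition (nodeExponents E A B)ᶜ d := by
  induction h with
  | @done A B k h =>
    convert hasStanleyPartition_vars (B := B) (d := d) (by omega) using 1
    ext t
    rw [Set.mem_compl_iff, mem_nodeExponents_of_hit hAB h]
    simp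
  | @dead A B e k he h =>
    convert hasStanleyPartition_empty (σ := σ) d using 1
    refine Set.compl_empty_iff.2 (Set.eq_univ_of_forall fun t => ?_)
    exact .inl ⟨e, he, h.trans Finset.subset_union_right⟩
  | @query A B k x hA hB _ _ ih₁ ih₂ =>
    refine .split x ?_ ?_
    · convert ih₁ (Finset.disjoint_insert_left.2 ⟨hB, hAB⟩) (by omega) using 1
      ext t
      exact not_congr (add_single_mem_nodeExponents hB t)
    · convert ih₂ (Finset.disjoint_insert_right.2 ⟨hA, hAB⟩)
        (by rw [Finset.card_insert_of_notMem hB]; omega) using 1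
      ext t
      rw [Set.mem_compl_iff, mem_nodeExponents_insert, not_or, not_not]
      rfl

section

variable {K : Type*} [Field K] {σ : Type*} {U : Set (σ →₀ ℕ)} (hU : IsUpperSet U)

local notation "I" => MvPolynomial.restrictSupportIdeal K U hU

lemma mk_eq_zero_iff_restrictSupportIdeal (f : MvPolynomial σ K) :
    Ideal.Quotient.mk I f = 0 ↔ ∀ s, f.coeff s ≠ 0 → s ∈ U := by
  rw [Ideal.Quotient.eq_zero_iff_mem]
  refine (MvPolynomial.mem_restrictSupport_iff K).trans ?_
  simp [Set.subset_def]

/-- The monomials outside a monomial ideal are linearly independent modulo it. -/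
lemma linearIndependent_mk_monomial :
    LinearIndependent K fun t : ↥Uᶜ => Ideal.Quotient.mk I (MvPolynomial.monomial t.1 1) := by
  have h : LinearIndependent K fun t : ↥Uᶜ => (MvPolynomial.monomial t.1 (1 : K)) :=
    (MvPolynomial.basisMonomials σ K).linearIndependent.comp _ Subtype.val_injective
  refine h.map (f := (Ideal.Quotient.mkₐ K I).toLinearMap) ?_
  rw [Submodule.disjoint_def]
  intro f hf hf'
  have h0 := (mk_eq_zero_iff_restrictSupportIdeal hU f).1 hf'
  have hf : f ∈ MvPolynomial.restrictSupport K Uᶜ := by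
    rw [MvPolynomial.restrictSupport_eq_span]
    rwa [Set.image_eq_range]
  rw [MvPolynomial.mem_restrictSupport_iff] at hf
  ext s
  by_contra hs
  exact hf (MvPolynomial.mem_support_iff.2 hs) (h0 s hs)

lemma span_mk_monomial_eq_top :
    Submodule.span K (Set.range fun t : ↥Uᶜ =>
      Ideal.Quotient.mk I (MvPolynomial.monomial t.1 1)) = ⊤ := by
  classical
  refine eq_top_iff.2 fun f _ => ?_
  obtain ⟨f, rfl⟩ := Ideal.Quotient.mk_surjective f
  induction f using MvPolynomial.induction_on' with
  | add p q hp hq =>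
    exact map_add (Ideal.Quotient.mk I) p q ▸ Submodule.add_mem _ (hp trivial) (hq trivial)
  | monomial s a =>
    by_cases hs : s ∈ U
    · rw [(mk_eq_zero_iff_restrictSupportIdeal hU _).2]
      · exact Submodule.zero_mem _
      · intro t ht
        rw [MvPolynomial.coeff_monomial] at ht
        exact (ite_ne_right_iff.1 ht).1 ▸ hs
    · rw [← mul_one a, ← smul_eq_mul, ← MvPolynomial.smul_monomial]
      exact Submodule.smul_mem _ a (Submodule.subset_span (Set.mem_range_self (⟨s, hs⟩ : ↥Uᶜ)))

/-- A partition of the exponents outside a monomial ideal into cells is a Stanley decomposition of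
the quotient. -/
lemma le_stanleyDepth_of_hasStanleyPartition {d : ℕ} (h : HasStanleyPartition Uᶜ d) :
    (d : ℕ∞) ≤ stanleyDepth (quotientMultigrading I) := by
  obtain ⟨ι, _, s, Z, hd, hc, hu⟩ := h
  obtain ⟨r, ⟨e⟩⟩ := Finite.exists_equiv_fin ι
  let b : ↥Uᶜ → MvPolynomial σ K ⧸ I := fun t => Ideal.Quotient.mk I (MvPolynomial.monomial t.1 1)
  let C : Fin r → Set ↥Uᶜ := fun i =>
    {t | ∃ w : σ →₀ ℕ, w.support ⊆ Z (e.symm i) ∧ t.1 = w + s (e.symm i)}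
  let u : Fin r → MvPolynomial σ K ⧸ I := fun i =>
    Ideal.Quotient.mk I (MvPolynomial.monomial (s (e.symm i)) 1)
  have hspan : ∀ i, stanleySubspace K (u i) (Z (e.symm i)) = Submodule.span K (b '' C i) := by
    intro i
    refine congrArg _ (Set.ext fun f => ?_)
    have hmul : ∀ w : σ →₀ ℕ, MvPolynomial.monomial w (1 : K) • u i =
        Ideal.Quotient.mk I (MvPolynomial.monomial (w + s (e.symm i)) 1) := by
      intro w
      rw [← mul_one (1 : K), ← MvPolynomial.monomial_mul, mul_one]
      rfl
    constructor
    · rintro ⟨w, hw, rfl⟩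
      exact ⟨⟨_, hc _ w hw⟩, ⟨w, hw, rfl⟩, (hmul w).symm⟩
    · rintro ⟨⟨t, ht⟩, ⟨w, hw, rfl⟩, rfl⟩
      exact ⟨w, hw, (hmul w).symm⟩
  have hb := linearIndependent_mk_monomial (K := K) hU
  have hdisj : ∀ i j t, t ∈ C i → t ∈ C j → i = j := fun i j t hi hj =>
    e.symm.injective ((hu t.1 t.2).unique hi hj)
  let D : StanleyDecomposition (quotientMultigrading I) :=
    { r := r
      u := u
      Z := fun i => Z (e.symm i)
      isStanleySpace := fun i => by
        refine ⟨⟨fun v => s (e.symm i) v, Submodule.subset_span ⟨_, fun _ => rfl, rfl⟩⟩, ?_⟩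
        intro f hf h0
        by_contra hne
        obtain ⟨w, hw⟩ := MvPolynomial.ne_zero_iff.1 hne
        refine hc (e.symm i) w (fun v hv => ?_)
          ((mk_eq_zero_iff_restrictSupportIdeal (K := K) hU
            (f * MvPolynomial.monomial (s (e.symm i)) 1)).1 h0 _ ?_)
        · exact MvPolynomial.mem_supported.1 hf ((MvPolynomial.mem_vars_iff_mem_support v).2
            ⟨w, MvPolynomial.mem_support_iff.2 hw, hv⟩)
        · rwa [MvPolynomial.coeff_mul_monomial, mul_one]
      isInternal := by
        refine DirectSum.isInternal_submodule_of_iSupIndep_of_iSup_eq_top ?_ ?_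
        · intro i
          simp only [hspan, ← Submodule.span_iUnion, ← Set.image_iUnion]
          refine hb.disjoint_span_image (Set.disjoint_left.2 fun t hi ht => ?_)
          simp only [Set.mem_iUnion] at ht
          obtain ⟨j, hj, ht⟩ := ht
          exact hj (hdisj _ _ t ht hi)
        · simp only [hspan, ← Submodule.span_iUnion, ← Set.image_iUnion]
          rw [← span_mk_monomial_eq_top hU, ← Set.image_univ]
          congr 2
          refine Set.eq_univ_of_forall fun t => Set.mem_iUnion.2 ?_
          obtain ⟨i, hi, -⟩ := hu t.1 t.2
          exact ⟨e i, by simpa [C] using hi⟩ }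
  exact le_iSup_of_le D (le_iInf fun i => Nat.cast_le.2 (hd (e.symm i)))

end

/-! ### Decision trees for paths and cycles -/

section

variable {σ : Type*} {v : ℕ → σ} {n : ℕ}

/-- The window at `i` contains a killed vertex. -/
def IsHit (v : ℕ → σ) (B : Finset σ) (i : ℕ) : Prop :=
  v i ∈ B ∨ v (i + 1) ∈ B ∨ v (i + 2) ∈ B

/-- The vertices `v p, …, v (q - 1)` are undecided. -/
def IsFresh (v : ℕ → σ) (A B : Finset σ) (p q : ℕ) : Prop :=
  ∀ i, p ≤ i → i < q → v i ∉ A ∧ v i ∉ B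

lemma IsHit.mono {A B : Finset σ} {i : ℕ} (h : IsHit v A i) (hAB : A ⊆ B) : IsHit v B i :=
  h.imp (@hAB _) (Or.imp (@hAB _) (@hAB _))

variable [DecidableEq σ]

/-- The three consecutive vertices `v i`, `v (i + 1)`, `v (i + 2)`. -/
def window (v : ℕ → σ) (i : ℕ) : Finset σ := {v i, v (i + 1), v (i + 2)}

/-- The first `n` windows. -/
def windows (v : ℕ → σ) (n : ℕ) : Set (Finset σ) := {e | ∃ i < n, e = window v i}

lemma hasDecisionTree_of_forall_isHit {A B : Finset σ} {k : ℕ} (h : ∀ i < n, IsHit v B i) :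
    HasDecisionTree (windows v n) A B k := by
  refine .done ?_
  rintro _ ⟨i, hi, rfl⟩
  have := h i hi
  simp only [IsHit] at this
  simp only [window, Finset.mem_insert, Finset.mem_singleton]
  grind

lemma hasDecisionTree_of_window_subset {A B : Finset σ} {k i : ℕ} (hi : i < n) (h₀ : v i ∈ A)
    (h₁ : v (i + 1) ∈ A) (h₂ : v (i + 2) ∈ A) : HasDecisionTree (windows v n) A B k :=
  .dead ⟨i, hi, rfl⟩ (by simp [window, Finset.insert_subset_iff, h₀, h₁, h₂])

lemma isHit_insert {B : Finset σ} {i j : ℕ} (h : i ≤ j) (h' : j ≤ i + 2) :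
    IsHit v (insert (v j) B) i := by
  obtain rfl | rfl | rfl : j = i ∨ j = i + 1 ∨ j = i + 2 := by omega
  all_goals simp [IsHit]

lemma IsFresh.query {E : Set (Finset σ)} {A B : Finset σ} {p q k : ℕ} (h : IsFresh v A B p q)
    (i : ℕ) (hi : p ≤ i ∧ i < q) (h₁ : HasDecisionTree E (insert (v i) A) B (k + 1))
    (h₂ : HasDecisionTree E A (insert (v i) B) k) : HasDecisionTree E A B (k + 1) :=
  .query (v i) (h i hi.1 hi.2).1 (h i hi.1 hi.2).2 h₁ h₂

lemma notMem_insert_of_injOn {A : Finset σ} {i j : ℕ} (hv : Set.InjOn v (Set.Iio n)) (hi : i < n)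
    (hj : j < n) (hij : i ≠ j) (h : v i ∉ A) : v i ∉ insert (v j) A := by
  rw [Finset.mem_insert, not_or]
  exact ⟨fun h' => hij (hv hi hj h'), h⟩

lemma IsFresh.insert_left {A B : Finset σ} {p q : ℕ} (h : IsFresh v A B p q)
    (hv : Set.InjOn v (Set.Iio n)) (p' q' i : ℕ)
    (hi : p ≤ p' ∧ q' ≤ q ∧ q ≤ n ∧ i < n ∧ (i < p' ∨ q' ≤ i)) :
    IsFresh v (insert (v i) A) B p' q' := fun j hj hj' =>
  have hfj := h j (by omega) (by omega)
  ⟨notMem_insert_of_injOn hv (by omega) (by omega) (by omega) hfj.1, hfj.2⟩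

lemma IsFresh.insert_right {A B : Finset σ} {p q : ℕ} (h : IsFresh v A B p q)
    (hv : Set.InjOn v (Set.Iio n)) (p' q' i : ℕ)
    (hi : p ≤ p' ∧ q' ≤ q ∧ q ≤ n ∧ i < n ∧ (i < p' ∨ q' ≤ i)) :
    IsFresh v A (insert (v i) B) p' q' := fun j hj hj' =>
  have hfj := h j (by omega) (by omega)
  ⟨hfj.1, notMem_insert_of_injOn hv (by omega) (by omega) (by omega) hfj.2⟩

/-- On a path with `m` fresh vertices, possibly preceded by an inverted one, `⌊m/2⌋` kills are
enough, if every other window is hit. The vertex `v (p + 1)` is queried first and, if it is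
inverted, `v p` next. -/
lemma hasDecisionTree_markedPath (hv : Set.InjOn v (Set.Iio n)) (m : ℕ) {p : ℕ} {A B : Finset σ}
    (hn : p + m ≤ n) (hf : IsFresh v A B p (p + m))
    (hw : ∀ i < n, IsHit v B i ∨ i + 3 ≤ p + m ∧ (p ≤ i ∨ i + 1 = p ∧ v i ∈ A)) :
    HasDecisionTree (windows v n) A B (m / 2) := by
  induction m using Nat.strong_induction_on generalizing p A B with
  | _ m ih =>
  obtain hm | hm := Nat.lt_or_ge m 2
  · refine hasDecisionTree_of_forall_isHit fun i hi => (hw i hi).resolve_right ?_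
    omega
  obtain ⟨m, rfl⟩ := Nat.exists_eq_add_of_le' hm
  rw [Nat.add_div_right _ two_pos]
  refine hf.query (p + 1) (by omega) ?_ ?_
  · have hf' := hf.insert_left hv (p + 2) (p + (m + 2)) (p + 1) (by omega)
    refine (hf.insert_left hv p (p + 1) (p + 1) (by omega)).query p (by omega) ?_ ?_
    · -- With `v p` and `v (p + 1)` inverted, an inverted `v (p - 1)` ends the branch, and otherwise
      -- the kill of `v (p + 2)` is forced.
      by_cases hd : ∃ i < n, i + 1 = p ∧ v i ∈ A
      · obtain ⟨i, hi, rfl, hA⟩ := hd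
        exact hasDecisionTree_of_window_subset hi (by simp [hA]) (by simp) (by simp)
      push Not at hd
      have hw' : ∀ i < n, IsHit v B i ∨ i + 3 ≤ p + (m + 2) ∧ p ≤ i := fun i hi =>
        (hw i hi).imp_right fun h => ⟨h.1, h.2.resolve_right fun h => hd i hi h.1 h.2⟩
      obtain _ | m := m
      · exact hasDecisionTree_of_forall_isHit fun i hi => (hw' i hi).resolve_right (by omega)
      have hf'' := hf'.insert_left hv (p + 2) (p + (m + 1 + 2)) p (by omega)
      refine hf''.query (p + 2) (by omega) ?_ ?_
      · exact hasDecisionTree_of_window_subset (i := p) (by omega) (by simp) (by simp) (by simp)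
      · refine (ih m (by omega) (p := p + 3) (by omega)
          (hf''.insert_right hv _ _ _ (by omega)) fun i hi => ?_).mono (by omega)
        obtain h | h := hw' i hi
        · exact .inl (h.mono (Finset.subset_insert _ _))
        obtain h' | h' := Nat.lt_or_ge (p + 2) i
        · exact .inr (by omega)
        · exact .inl (isHit_insert (by omega) (by omega))
    · refine ih m (by omega) (p := p + 2) (by omega)
        (hf'.insert_right hv _ _ _ (by omega)) fun i hi => ?_
      obtain h | h := hw i hi
      · exact .inl (h.mono (Finset.subset_insert _ _))
      obtain h' | rfl | h' := Nat.lt_trichotomy i (p + 1)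
      · exact .inl (isHit_insert (by omega) (by omega))
      · exact .inr (by simp; omega)
      · exact .inr (by omega)
  · refine ih m (by omega) (p := p + 2) (by omega)
      (hf.insert_right hv _ _ _ (by omega)) fun i hi => ?_
    obtain h | h := hw i hi
    · exact .inl (h.mono (Finset.subset_insert _ _))
    obtain h' | h' := Nat.lt_or_ge (p + 1) i
    · exact .inr (by omega)
    · exact .inl (isHit_insert (by omega) (by omega))

/-- On a path with `m` fresh vertices `⌊m/4⌋ + ⌊(m+1)/4⌋` kills are enough, if every window outside
the path is hit. The vertex `v (p + 2)` is queried first and, if it is inverted, `v (p + 1)` next.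
-/
lemma hasDecisionTree_path (hv : Set.InjOn v (Set.Iio n)) (m : ℕ) {p : ℕ} {A B : Finset σ}
    (hn : p + m ≤ n) (hf : IsFresh v A B p (p + m))
    (hw : ∀ i < n, IsHit v B i ∨ i + 3 ≤ p + m ∧ p ≤ i) :
    HasDecisionTree (windows v n) A B (m / 4 + (m + 1) / 4) := by
  induction m using Nat.strong_induction_on generalizing p A B with
  | _ m ih =>
  obtain hm | rfl | hm : m < 3 ∨ m = 3 ∨ 4 ≤ m := by omega
  · exact hasDecisionTree_of_forall_isHit fun i hi => (hw i hi).resolve_right (by omega)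
  · exact hasDecisionTree_markedPath hv 3 hn hf fun i hi =>
      (hw i hi).imp_right fun h => ⟨h.1, .inl h.2⟩
  obtain ⟨m, rfl⟩ := Nat.exists_eq_add_of_le' hm
  rw [show (m + 4) / 4 + (m + 4 + 1) / 4 = m / 4 + (m + 1) / 4 + 1 + 1 by omega]
  refine hf.query (p + 2) (by omega) ?_ ?_
  · have hf' := hf.insert_left hv (p + 3) (p + (m + 4)) (p + 2) (by omega)
    refine (hf.insert_left hv p (p + 2) (p + 2) (by omega)).query (p + 1) (by omega) ?_ ?_
    · -- With `v (p + 1)` and `v (p + 2)` inverted, `v p` and `v (p + 3)` must be killed.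
      have hf₂ := hf'.insert_left hv (p + 3) (p + (m + 4)) (p + 1) (by omega)
      refine ((hf.insert_left hv p (p + 2) (p + 2) (by omega)).insert_left hv p (p + 1) (p + 1)
        (by omega)).query p (by omega) ?_ ?_
      · exact hasDecisionTree_of_window_subset (i := p) (by omega) (by simp) (by simp) (by simp)
      have hf₃ := hf₂.insert_right hv (p + 3) (p + (m + 4)) p (by omega)
      refine hf₃.query (p + 3) (by omega) ?_ ?_
      · exact hasDecisionTree_of_window_subset (i := p + 1) (by omega) (by simp) (by simp) (by simp)
      refine ih m (by omega) (p := p + 4) (by omega)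
        (hf₃.insert_right hv _ _ _ (by omega)) fun i hi => ?_
      obtain h | h := hw i hi
      · exact .inl (h.mono ((Finset.subset_insert _ _).trans (Finset.subset_insert _ _)))
      obtain rfl | h' : i = p ∨ p + 1 ≤ i := by omega
      · exact .inl ((isHit_insert (by omega) (by omega)).mono (Finset.subset_insert _ _))
      obtain h'' | h'' := Nat.lt_or_ge (p + 3) i
      · exact .inr (by omega)
      · exact .inl (isHit_insert (by omega) (by omega))
    · refine (hasDecisionTree_markedPath hv (m + 1) (p := p + 3) (by omega)
        (hf'.insert_right hv _ _ _ (by omega)) fun i hi => ?_).mono (by omega)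
      obtain h | h := hw i hi
      · exact .inl (h.mono (Finset.subset_insert _ _))
      obtain h' | rfl | h' := Nat.lt_trichotomy i (p + 2)
      · exact .inl (isHit_insert (by omega) (by omega))
      · exact .inr (by simp; omega)
      · exact .inr (by omega)
  · refine (ih (m + 1) (by omega) (p := p + 3) (by omega)
      (hf.insert_right hv _ _ _ (by omega)) fun i hi => ?_).mono (by omega)
    obtain h | h := hw i hi
    · exact .inl (h.mono (Finset.subset_insert _ _))
    obtain h' | h' := Nat.lt_or_ge (p + 2) i
    · exact .inr (by omega)
    · exact .inl (isHit_insert (by omega) (by omega))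

/-- On the `n`-cycle `⌊n/4⌋ + ⌈n/4⌉` kills are enough. The vertex `v 0` is queried first and, if
it is inverted, `v (n - 1)` next. -/
lemma hasDecisionTree_cycle (hv : Set.InjOn v (Set.Iio n)) (hn : 3 ≤ n) (h₀ : v n = v 0)
    (h₁ : v (n + 1) = v 1) : HasDecisionTree (windows v n) ∅ ∅ (n / 4 + (n + 3) / 4) := by
  obtain ⟨m, rfl⟩ := Nat.exists_eq_add_of_le' hn
  have hf : IsFresh v (∅ : Finset σ) ∅ 0 (m + 3) := fun i _ _ => by simp
  rw [show (m + 3) / 4 + (m + 3 + 3) / 4 = (m + 3) / 4 + (m + 2) / 4 + 1 by omega]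
  refine hf.query 0 (by omega) ?_ ?_
  · have hf' := hf.insert_left hv 1 (m + 3) 0 (by omega)
    refine hf'.query (m + 2) (by omega) ?_ ?_
    · -- With `v (n - 1)` and `v 0` inverted, their neighbours `v 1` and `v (n - 2)` must be killed.
      have hf₂ := hf'.insert_left hv 1 (m + 2) (m + 2) (by omega)
      by_cases hm : m = 0
      · subst hm
        refine hf₂.query 1 (by omega) ?_ (hasDecisionTree_of_forall_isHit fun i hi => ?_)
        · exact hasDecisionTree_of_window_subset (i := 0) (by omega) (by simp) (by simp) (by simp)
        · obtain h | rfl : i < 2 ∨ i = 2 := by omega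
          · exact isHit_insert (by omega) (by omega)
          · rw [← h₁]
            exact isHit_insert (by omega) (by omega)
      obtain ⟨m, rfl⟩ := Nat.exists_eq_succ_of_ne_zero hm
      refine hf₂.query 1 (by omega) ?_ ?_
      · exact hasDecisionTree_of_window_subset (i := m + 3) (by omega) (by simp)
          (by simp [← h₀]) (by simp [← h₁])
      have hf₃ := hf₂.insert_right hv 2 (m + 3) 1 (by omega)
      rw [show (m + 1 + 3) / 4 + (m + 1 + 2) / 4 = m / 4 + (m + 3) / 4 + 1 by omega]
      refine hf₃.query (m + 2) (by omega) ?_ ?_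
      · exact hasDecisionTree_of_window_subset (i := m + 2) (by omega) (by simp)
          (by simp) (by simp [← h₀])
      refine (hasDecisionTree_path hv m (p := 2) (by omega)
        (hf₃.insert_right hv _ _ _ (by omega)) fun i hi => ?_).mono (by omega)
      obtain h | h : i < 2 ∨ 2 ≤ i := by omega
      · exact .inl ((isHit_insert (by omega) (by omega)).mono (Finset.subset_insert _ _))
      obtain h' | h' | rfl : i + 1 ≤ m ∨ (m ≤ i ∧ i ≤ m + 2) ∨ i = m + 3 := by omega
      · exact .inr (by omega)
      · exact .inl (isHit_insert (by omega) (by omega))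
      · rw [← h₁]
        exact .inl ((isHit_insert (by omega) (by omega)).mono (Finset.subset_insert _ _))
    · refine (hasDecisionTree_markedPath hv (m + 1) (p := 1) (by omega)
        (hf'.insert_right hv _ _ _ (by omega)) fun i hi => ?_).mono (by omega)
      obtain rfl | h := Nat.eq_zero_or_pos i
      · by_cases hm : m = 0
        · subst hm
          exact .inl (isHit_insert (by omega) (by omega))
        · exact .inr (by simp; omega)
      obtain h' | h' := Nat.lt_or_ge i m
      · exact .inr (by omega)
      · exact .inl (isHit_insert (by omega) (by omega))
  · refine (hasDecisionTree_path hv (m + 2) (p := 1) (by omega)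
      (hf.insert_right hv _ _ _ (by omega)) fun i hi => ?_).mono (by omega)
    obtain rfl | h := Nat.eq_zero_or_pos i
    · exact .inl (isHit_insert (by omega) (by omega))
    rw [← h₀]
    obtain h' | h' := Nat.lt_or_ge i (m + 1)
    · exact .inr (by omega)
    · exact .inl (isHit_insert (by omega) (by omega))

end

/-! ### The path ideal of the cycle -/

/-- The vertices of the `(m + 3)`-cycle, listed periodically: `i` is read modulo `m + 3`. -/
def cycleVertex (m i : ℕ) : Fin (m + 3) := Fin.ofNat (m + 3) i

lemma cycleVertex_add_one (m i : ℕ) : cycleVertex m (i + 1) = cycleVertex m i + 1 := by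
  ext
  simp [cycleVertex, Fin.val_add]

lemma cycleVertex_injOn (m : ℕ) : Set.InjOn (cycleVertex m) (Set.Iio (m + 3)) := by
  intro i hi j hj h
  simpa [cycleVertex, Fin.ext_iff, Nat.mod_eq_of_lt hi, Nat.mod_eq_of_lt hj] using h

lemma cycleVertex_val {m : ℕ} (u : Fin (m + 3)) : cycleVertex m u = u := by
  simp [cycleVertex]

section

open MvPolynomial

lemma X_mul_X_mul_X_eq_monomial {K σ : Type*} [Field K] (a b c : σ) :
    (X a * X b * X c : MvPolynomial σ K) =
      monomial (Finsupp.single a 1 + Finsupp.single b 1 + Finsupp.single c 1) 1 := by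
  simp [X, monomial_mul]

lemma X_mul_X_mul_X_dvd_monomial {K σ : Type*} [Field K] {a b c : σ} (hab : a ≠ b)
    (hac : a ≠ c) (hbc : b ≠ c) {s : σ →₀ ℕ} (r : K) (ha : s a ≠ 0) (hb : s b ≠ 0)
    (hc : s c ≠ 0) : X a * X b * X c ∣ monomial s r := by
  classical
  rw [X_mul_X_mul_X_eq_monomial, monomial_dvd_monomial]
  refine ⟨.inr fun v => ?_, one_dvd _⟩
  simp only [Finsupp.add_apply, Finsupp.single_apply]
  grind

lemma windowProduct_mem_nodeIdeal (K : Type*) [Field K] {m : ℕ} (u : Fin (m + 3)) :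
    (X u * X (u + 1) * X (u + 1 + 1) : MvPolynomial (Fin (m + 3)) K) ∈
      nodeIdeal K (windows (cycleVertex m) (m + 3)) ∅ ∅ := by
  rw [mem_nodeIdeal, X_mul_X_mul_X_eq_monomial]
  intro s hs
  rw [coeff_monomial] at hs
  obtain rfl := (ite_ne_right_iff.1 hs).1
  refine .inl ⟨_, ⟨u, u.2, rfl⟩, ?_⟩
  simp only [window, cycleVertex_add_one, cycleVertex_val]
  intro w hw
  simp only [Finset.mem_insert, Finset.mem_singleton] at hw
  simp only [Finset.union_empty, Finsupp.mem_support_iff, Finsupp.add_apply, Finsupp.single_apply]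
  grind

lemma fin_add_one_add_one_ne {m : ℕ} (u : Fin (m + 3)) : u + 1 + 1 ≠ u := by
  rw [add_assoc, Ne, add_eq_left, Fin.ext_iff]
  simp [Fin.val_add, Nat.mod_eq_of_lt (show 2 < m + 3 by omega)]

/-- A path with three vertices in a cycle runs through consecutive vertices in one of the two
directions, the case of two opposite steps being excluded by `p.IsPath`. -/
lemma cyclePathIdeal_three_eq_nodeIdeal (K : Type*) [Field K] (m : ℕ) :
    cyclePathIdeal K (m + 3) 3 = nodeIdeal K (windows (cycleVertex m) (m + 3)) ∅ ∅ := by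
  have hadj : ∀ u w : Fin (m + 3), (SimpleGraph.cycleGraph (m + 3)).Adj u w ↔
      u = w + 1 ∨ w = u + 1 := by
    intro u w
    rw [SimpleGraph.cycleGraph_adj, sub_eq_iff_eq_add', sub_eq_iff_eq_add']
  apply le_antisymm
  · refine Ideal.span_le.2 ?_
    rintro _ ⟨u, w, p, hp, hl, rfl⟩
    match p, hp, hl with
    | .cons (v := a) h (.cons (v := b) h' .nil), hp, _ =>
      have hub : u ≠ b := by
        rintro rfl
        simp at hp
      rw [hadj] at h h'
      simp only [SimpleGraph.Walk.support_cons, SimpleGraph.Walk.support_nil, List.map_cons,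
        List.map_nil, List.prod_cons, List.prod_nil, mul_one]
      obtain rfl | rfl := h <;> obtain h | h := h'
      · subst h
        have := windowProduct_mem_nodeIdeal K b
        rwa [mul_comm, mul_comm (X b)] at this
      · exact absurd h.symm hub
      · exact absurd (add_right_cancel h) hub
      · subst h
        have := windowProduct_mem_nodeIdeal K u
        rwa [mul_assoc] at this
  · intro f hf
    rw [mem_nodeIdeal] at hf
    rw [f.as_sum]
    refine Ideal.sum_mem _ fun s hs => ?_
    obtain ⟨e, ⟨i, hi, rfl⟩, hes⟩ | ⟨b, hb, -⟩ := hf s (mem_support_iff.1 hs)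
    · simp only [window, cycleVertex_add_one, Finset.union_empty, Finset.insert_subset_iff,
        Finset.singleton_subset_iff, Finsupp.mem_support_iff] at hes
      generalize cycleVertex m i = u at hes
      have h₁ : ∀ u : Fin (m + 3), u ≠ u + 1 := fun u => by simp
      refine Ideal.mem_of_dvd _ (X_mul_X_mul_X_dvd_monomial (h₁ u) (fin_add_one_add_one_ne u).symm
        (h₁ _) _ hes.1 hes.2.1 hes.2.2) (Ideal.subset_span ?_)
      refine ⟨u, u + 1 + 1, .cons ((hadj _ _).2 (.inr rfl)) (.cons ((hadj _ _).2 (.inr rfl)) .nil),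
        ?_, rfl, ?_⟩
      · simp [(fin_add_one_add_one_ne u).symm]
      · simp [mul_assoc]
    · simp at hb

end

theorem theorem2p5 {K : Type*} [Field K] (n : ℕ) (hn : 3 ≤ n) :
    ((n - ⌊(n : ℚ) / 4⌋₊ - ⌈(n : ℚ) / 4⌉₊ : ℕ) : ℕ∞) ≤
        gradedDepth K (Fin n) (MvPolynomial (Fin n) K ⧸ cyclePathIdeal K n 3) ∧
      ((n - ⌊(n : ℚ) / 4⌋₊ - ⌈(n : ℚ) / 4⌉₊ : ℕ) : ℕ∞) ≤
        stanleyDepth (quotientMultigrading (cyclePathIdeal K n 3)) := by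
  have hfloor : ⌊(n : ℚ) / 4⌋₊ = n / 4 := by
    exact_mod_cast Nat.floor_div_natCast (n : ℚ) 4
  have hceil : ⌈(n : ℚ) / 4⌉₊ = (n + 3) / 4 := by
    refine (Nat.ceil_eq_iff (by omega)).2 ⟨?_, ?_⟩
    · rw [lt_div_iff₀ (by norm_num)]
      exact_mod_cast (by omega : ((n + 3) / 4 - 1) * 4 < n)
    · rw [div_le_iff₀ (by norm_num)]
      exact_mod_cast (by omega : n ≤ (n + 3) / 4 * 4)
  rw [hfloor, hceil]
  obtain ⟨m, rfl⟩ := Nat.exists_eq_add_of_le' hn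
  have h := hasDecisionTree_cycle (cycleVertex_injOn m) hn (by simp [cycleVertex])
    (by ext; simp [cycleVertex])
  rw [cyclePathIdeal_three_eq_nodeIdeal]
  constructor
  · refine le_iInf₂ fun i hi => Nat.cast_le.2 (le_of_not_gt fun hlt =>
      not_subsingleton_iff_nontrivial.2 hi ?_)
    exact h.subsingleton_ext K (Finset.disjoint_empty_left _) (by simp; omega)
  · exact le_stanleyDepth_of_hasStanleyPartition _
      (h.hasStanleyPartition (Finset.disjoint_empty_left _) (by simp; omega))
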